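/- Let $F\colon\mathbb{R}^d\to\mathbb{R}^d$ be $L$-Lipschitz, let $G\colon\mathbb{R}^d\rightrightarrows\mathbb{R}^d$ be maximally monotone, and let $0<\rho<\eta<\frac1L$ (for $L=0$ the last inequality is void). For a set-valued operator $A$ on $\mathbb{R}^d$ write $J_A=(\mathrm{Id}+A)^{-1}$. Suppose that $x^\star$ is a solution of $0\in F(x^\star)+G(x^\star)$ that satisfies the $\rho$-weak Minty variational inequality $$\langle u,x-x^\star\rangle\ge-\rho\|u\|^2\qquad\text{for all }x\in\mathbb{R}^d\text{ and }u\in F(x)+G(x).$$ Given $x_0\in\mathbb{R}^d$, put $\alpha=1-\frac{\rho}{\eta}$ and, for $k=0,1,2,\dots$, $$x_{k+1}=(1-\alpha)x_k+\alpha z^{(k)}_{N_k},\qquad N_k=\left\lceil\frac{4(1+\eta L)}{1-\eta L}\log\bigl(8(k+1)\log^2(k+2)\bigr)\right\rceil,$$ where $z^{(k)}_{N_k}$ is the result of $N_k$ steps of the forward-backward-forward method started at $z^{(k)}_0=x_k$: with $\tau=\frac{1}{2(1+\eta L)}$ and $B_k(z)=z+\eta F(z)-x_k$, $$z^{(k)}_{t+1/2}=J_{\tau\eta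 G}\bigl(z^{(k)}_t-\tau B_k(z^{(k)}_t)\bigr),\qquad z^{(k)}_{t+1}=z^{(k)}_{t+1/2}+\tau B_k(z^{(k)}_t)-\tau B_k(z^{(k)}_{t+1/2}).$$ Then $J_{\gamma G}$ (for every $\gamma>0$) and $J_{\eta(F+G)}$ are single-valued and defined on all of $\mathbb{R}^d$, and for every $K\ge1$ $$\frac1K\sum_{k=0}^{K-1}\frac1{\eta^2}\bigl\|x_k-J_{\eta(F+G)}(x_k)\bigr\|^2\le\frac{11\|x_0-x^\star\|^2}{(\eta-\rho)^2K}.$$ Moreover, every iteration $k$ (the computation of $x_{k+1}$ from $x_k$) uses at most $2N_k$ first-order oracle calls, where one call consists of one evaluation of $F$ and one evaluation of a resolvent $J_{\gamma G}$ (so that $n$ calls provide $n$ evaluations of $F$ and $n$ resolvents of $G$). -/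

import Mathlib

open scoped NNReal

namespace WeakMVI

/-! ### Set-valued operators on a real inner product space `E` -/

section Operators

variable {E : Type*} [NormedAddCommGroup E] [InnerProductSpace ℝ E]

/-- The sum `F + G` of a single-valued operator `F` and a set-valued operator `G`. -/
def addOp (F : E → E) (G : E → Set E) : E → Set E :=
  fun x => {u | ∃ g ∈ G x, u = F x + g}

/-- The multiple `γ A` of a set-valued operator `A`. -/
def smulOp (γ : ℝ) (A : E → Set E) : E → Set E :=
  fun x => {u | ∃ a ∈ A x, u = γ • a}

/-- Monotonicity: `⟨u - v, x - y⟩ ≥ 0` for all `(x, u)`, `(y, v)` in the graph. -/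
def IsMonotoneOp (A : E → Set E) : Prop :=
  ∀ x y u v : E, u ∈ A x → v ∈ A y → 0 ≤ inner ℝ (u - v) (x - y)

/-- Maximal monotonicity: the graph of `A` is not strictly contained in the graph of another
monotone operator. -/
def IsMaximalMonotoneOp (A : E → Set E) : Prop :=
  IsMonotoneOp A ∧
    ∀ B : E → Set E, IsMonotoneOp B → (∀ x, A x ⊆ B x) → ∀ x, B x ⊆ A x

/-- `xs` is a solution of the inclusion `0 ∈ A x` that satisfies the `ρ`-weak Minty
variational inequality: `⟨u, x - xs⟩ ≥ -ρ ‖u‖²` for all `(x, u)` in the graph of `A`. -/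
def IsWeakMVISolution (ρ : ℝ) (A : E → Set E) (xs : E) : Prop :=
  0 ∈ A xs ∧ ∀ x u : E, u ∈ A x → -ρ * ‖u‖ ^ 2 ≤ inner ℝ u (x - xs)

/-- The (set-valued) resolvent `(Id + A)⁻¹`: `p` is in the resolvent at `x` iff
`x ∈ p + A p`. -/
def resolventOp (A : E → Set E) : E → Set E :=
  fun x => {p | ∃ a ∈ A p, x = p + a}

/-- `A` has a resolvent that is defined everywhere and single-valued. -/
def HasSingleValuedResolvent (A : E → Set E) : Prop :=
  ∀ x : E, ∃! p : E, p ∈ resolventOp A x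

/-- The value `J_A x` of the resolvent, as a point; it is meaningful at every `x` when
`HasSingleValuedResolvent A` holds. -/
noncomputable def J (A : E → Set E) (x : E) : E :=
  Classical.epsilon fun p => p ∈ resolventOp A x

end Operators

/-! ### Algorithms with access to first-order oracles

An algorithm sees `F` only through evaluations of `F` at query points and sees `G` only through
evaluations of resolvents `J_{γ G}`. It is written as a program whose nodes are such queries,
and its cost is counted along its run. -/

/-- Programs over the space `E` with a result in `α`. -/
inductive Prog (E : Type) (α : Type) : Type
  /-- Return a result. -/
  | ret (a : α) : Prog E α
  /-- Query `F x`, and continue with the answer. -/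
  | evalF (x : E) (cont : E → Prog E α) : Prog E α
  /-- Query `J_{γ G} x`, and continue with the answer. -/
  | evalRes (γ : ℝ) (x : E) (cont : E → Prog E α) : Prog E α

namespace Prog

variable {E α β : Type}

/-- Sequential composition. -/
def bind : Prog E α → (α → Prog E β) → Prog E β
  | ret a, f => f a
  | evalF x c, f => evalF x fun v => (c v).bind f
  | evalRes γ x c, f => evalRes γ x fun v => (c v).bind f

/-- The result of a program, when `F x` is answered by `oF x` and `J_{γ G} x` by `oR γ x`. -/
def run (oF : E → E) (oR : ℝ → E → E) : Prog E α → α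
  | ret a => a
  | evalF x c => (c (oF x)).run oF oR
  | evalRes γ x c => (c (oR γ x)).run oF oR

/-- The number of evaluations of `F` during the run. -/
def countF (oF : E → E) (oR : ℝ → E → E) : Prog E α → ℕ
  | ret _ => 0
  | evalF x c => (c (oF x)).countF oF oR + 1
  | evalRes γ x c => (c (oR γ x)).countF oF oR

/-- The number of evaluations of resolvents of `G` during the run. -/
def countRes (oF : E → E) (oR : ℝ → E → E) : Prog E α → ℕ
  | ret _ => 0
  | evalF x c => (c (oF x)).countRes oF oR
  | evalRes γ x c => (c (oR γ x)).countRes oF oR + 1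

/-- The number of first-order oracle calls of the run. One call consists of one evaluation of `F`
and one evaluation of a resolvent of `G`, so the number of calls is the least `n` such that the
run makes at most `n` evaluations of `F` and at most `n` evaluations of resolvents of `G`. -/
def oracleCalls (oF : E → E) (oR : ℝ → E → E) (p : Prog E α) : ℕ :=
  max (p.countF oF oR) (p.countRes oF oR)

end Prog

section Algorithms

variable {E : Type} [NormedAddCommGroup E] [InnerProductSpace ℝ E]

/-- The forward-backward-forward method `FBF(z₀, N, A, B_in, L_B)`, with step size
`τ = 1 / (2 L_B)` and `B = B_in - z₀`. The program `bIn` evaluates `B_in`, and the program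
`resA τ` evaluates the resolvent `J_{τ A}`. -/
noncomputable def fbf (resA : ℝ → E → Prog E E) (bIn : E → Prog E E) (LB : ℝ) (z₀ : E) :
    ℕ → Prog E E
  | 0 => .ret z₀
  | t + 1 =>
    (fbf resA bIn LB z₀ t).bind fun z =>
      (bIn z).bind fun b =>
        (resA (1 / (2 * LB)) (z - (1 / (2 * LB)) • (b - z₀))).bind fun w =>
          (bIn w).bind fun b' =>
            .ret (w + (1 / (2 * LB)) • (b - z₀) - (1 / (2 * LB)) • (b' - z₀))

/-- The number of inner iterations at the outer iteration `k`:
`N_k = ⌈ 4 (1 + η L) / (1 - η L) * log (8 (k + 1) log² (k + 2)) ⌉`. -/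
noncomputable def innerIters (η L : ℝ) (k : ℕ) : ℕ :=
  ⌈4 * (1 + η * L) / (1 - η * L)
    * Real.log (8 * ((k : ℝ) + 1) * Real.log ((k : ℝ) + 2) ^ 2)⌉₊

/-- The approximate resolvent at the outer iteration `k`:
`FBF(x, N_k, η G, Id + η F, 1 + η L)`. Here `J_{τ (η G)}` is the query `J_{(τ η) G}`. -/
noncomputable def approxResolvent (η L : ℝ) (k : ℕ) (x : E) : Prog E E :=
  fbf (fun τ w => .evalRes (τ * η) w .ret) (fun z => .evalF z fun v => .ret (z + η • v))
    (1 + η * L) x (innerIters η L k)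

/-- Iteration `k` of the inexact Krasnosel'skii-Mann method, from the current iterate `x`:
with `α = 1 - ρ / η`, the next iterate is `(1 - α) x + α J̃(x)`. -/
noncomputable def kmStep (η L ρ : ℝ) (k : ℕ) (x : E) : Prog E E :=
  (approxResolvent η L k x).bind fun j => .ret ((1 - (1 - ρ / η)) • x + (1 - ρ / η) • j)

/-- The answers to the queries `J_{γ G} x`. -/
noncomputable def resOracle (G : E → Set E) (γ : ℝ) (x : E) : E := J (smulOp γ G) x

/-- The iterates `x_0, x_1, …` of the inexact Krasnosel'skii-Mann method. -/
noncomputable def kmIterate (F : E → E) (G : E → Set E) (η L ρ : ℝ) (x₀ : E) : ℕ → E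
  | 0 => x₀
  | k + 1 => (kmStep η L ρ k (kmIterate F G η L ρ x₀ k)).run F (resOracle G)

/-- The number of first-order oracle calls at iteration `k`. -/
noncomputable def kmCalls (F : E → E) (G : E → Set E) (η L ρ : ℝ) (x₀ : E) (k : ℕ) : ℕ :=
  (kmStep η L ρ k (kmIterate F G η L ρ x₀ k)).oracleCalls F (resOracle G)

end Algorithms

end WeakMVI

namespace WeakMVI

/-! Write `T = J_{η(F+G)}` and `α = 1 - ρ/η`. The weak Minty inequality at the point `T x` becomes
`α ‖x - T x‖² ≤ ⟨x - T x, x - x⋆⟩` (`IsWeakMVISolution.le_inner_sub`), so an exact relaxed step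
lowers `‖x - x⋆‖²` by at least `α² ‖x - T x‖²`. Since `ηL < 1`, `Id + ηF` is strongly monotone and
the inner method converges linearly to `T x` (`norm_run_fbfResolvent_sub_sq_le`). The choice of
`N_k` makes its squared error at most `ε_k ‖x_k - T x_k‖²` with `ε_k = (1.9 √(k+1))⁻³`
(`pow_innerIters_le`). This error costs half of the decrease and a factor `1 + 2 ε_k`
(`norm_sq_le_of_kmStep`). As `∑ ε_k ≤ 1/2`, these factors multiply to at most `e`, whence `α² ∑ ‖x_k
- T x_k‖² ≤ 2e ‖x₀ - x⋆‖²`, and `2e ≤ 11`. Resolvents of `G` exist by Minty's theorem (finite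
minimax, then compactness); `T` comes from Banach's fixed point theorem. -/

theorem HasSingleValuedResolvent.J_mem {E : Type*} [NormedAddCommGroup E] {A : E → Set E} (hA : HasSingleValuedResolvent A) (x : E) :
    J A x ∈ resolventOp A x :=
  Classical.epsilon_spec (p := fun p => p ∈ resolventOp A x) (hA x).exists

/-! ### Minty's theorem and existence of the resolvents. -/

section Minty

variable {E : Type*} [NormedAddCommGroup E] [InnerProductSpace ℝ E]

/-- A convex combination of monotonically related pairs: the mean of the pairings dominates the
pairing of the means. -/
theorem inner_mean_le_mean_inner {ι : Type*} [Fintype ι] (x v : ι → E)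
    (hmon : ∀ i j, 0 ≤ inner ℝ (v i - v j) (x i - x j)) {w : ι → ℝ}
    (hw : w ∈ stdSimplex ℝ ι) :
    inner ℝ (∑ i, w i • x i) (∑ i, w i • v i) ≤ ∑ i, w i * inner ℝ (x i) (v i) := by
  have h1 : ∑ i, w i = 1 := hw.2
  have h : 0 ≤ ∑ i, ∑ j, w i * w j * inner ℝ (v i - v j) (x i - x j) :=
    Finset.sum_nonneg fun i _ => Finset.sum_nonneg fun j _ =>
      mul_nonneg (mul_nonneg (hw.1 i) (hw.1 j)) (hmon i j)
  have e : ∀ i j, w i * w j * inner ℝ (v i - v j) (x i - x j)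
      = w j * (w i * inner ℝ (x i) (v i)) + w i * (w j * inner ℝ (x j) (v j))
        - inner ℝ (w j • x j) (w i • v i) - inner ℝ (w i • x i) (w j • v j) := by
    intro i j
    simp only [inner_sub_left, inner_sub_right, real_inner_smul_right,
      real_inner_comm (v i), real_inner_comm (v j)]
    simp only [real_inner_comm (x i), real_inner_comm (x j)]
    ring
  simp only [e, Finset.sum_sub_distrib, Finset.sum_add_distrib, ← Finset.mul_sum,
    ← Finset.sum_mul, h1, ← inner_sum, ← sum_inner] at h
  linarith

/-- Finitely many pairs of a monotone relation admit a common point `p` such that `(p, y - p)` is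
monotonically related to each of them. -/
theorem exists_monotone_related_of_fintype {ι : Type*} [Fintype ι] [Nonempty ι] (x v : ι → E)
    (hmon : ∀ i j, 0 ≤ inner ℝ (v i - v j) (x i - x j)) (y : E) :
    ∃ p : E, ∀ i, 0 ≤ inner ℝ (p - x i) (y - p - v i) := by
  classical
  set c : ι → E := fun i => x i + y - v i with hc
  set δ : ι → ℝ := fun i => inner ℝ (x i) (y - v i) with hδ
  -- `-q` is the Lagrangian dual of minimizing over `p` the maximum of `‖p‖² - ⟨p, c i⟩ + δ i = -⟨p
  -- - x i, y - p - v i⟩`. Monotonicity gives `q ≥ 0`, so the primal value is at most `0`; the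
  -- optimal `p` is half the optimal mean of the `c i`.
  let q : (ι → ℝ) → ℝ := fun w => ‖∑ i, w i • c i‖ ^ 2 / 4 - ∑ i, w i * δ i
  have hq : Continuous q := by fun_prop
  obtain ⟨i₀⟩ := ‹Nonempty ι›
  obtain ⟨w, hw, hmin⟩ := (isCompact_stdSimplex ℝ ι).exists_isMinOn
    ⟨_, single_mem_stdSimplex ℝ i₀⟩ hq.continuousOn
  have h1 : ∑ i, w i = 1 := hw.2
  have hqw : 0 ≤ q w := by
    have h2 := inner_mean_le_mean_inner x v hmon hw
    have e1 : ∑ i, w i • c i = ∑ i, w i • x i + (y - ∑ i, w i • v i) := by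
      simp only [hc, smul_add, smul_sub, Finset.sum_add_distrib, Finset.sum_sub_distrib,
        ← Finset.sum_smul, h1, one_smul]
      abel
    have e2 : ∑ i, w i * δ i = inner ℝ (∑ i, w i • x i) y - ∑ i, w i * inner ℝ (x i) (v i) := by
      simp only [hδ, inner_sub_right, mul_sub, Finset.sum_sub_distrib, sum_inner,
        real_inner_smul_left]
    have h3 := norm_add_sq_real (∑ i, w i • x i) (y - ∑ i, w i • v i)
    have h4 := norm_sub_sq_real (∑ i, w i • x i) (y - ∑ i, w i • v i)
    have h5 := sq_nonneg ‖(∑ i, w i • x i) - (y - ∑ i, w i • v i)‖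
    have h6 : inner ℝ (∑ i, w i • x i) (y - ∑ i, w i • v i)
      = inner ℝ (∑ i, w i • x i) y - inner ℝ (∑ i, w i • x i) (∑ i, w i • v i) :=
      inner_sub_right _ _ _
    simp only [q, e1, e2]
    linarith
  set p : E := (1 / 2 : ℝ) • ∑ i, w i • c i with hp
  have hpc : ∑ i, w i • c i = (2 : ℝ) • p := by rw [hp, smul_smul]; norm_num
  refine ⟨p, fun i => ?_⟩
  -- Optimality of `w` along the segment to vertex `i`, divided by `t`: slope plus `t` times
  -- curvature.
  have key : ∀ t : ℝ, 0 < t → t ≤ 1 →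
      0 ≤ (inner ℝ p (c i) - 2 * ‖p‖ ^ 2 - δ i + ∑ j, w j * δ j)
        + t * (‖c i - (2 : ℝ) • p‖ ^ 2 / 4) := by
    intro t ht ht1
    set w' : ι → ℝ := (1 - t) • w + t • Pi.single i 1 with hw'
    have hmem : w' ∈ stdSimplex ℝ ι :=
      convex_stdSimplex ℝ ι hw (single_mem_stdSimplex ℝ i) (by linarith) ht.le (by ring)
    have h := hmin hmem
    have e1 : ∑ j, w' j • c j = (2 : ℝ) • p + t • (c i - (2 : ℝ) • p) := by
      simp only [hw', Pi.add_apply, Pi.smul_apply, add_smul, smul_eq_mul, mul_smul,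
        Finset.sum_add_distrib, ← Finset.smul_sum, hpc]
      simp [Pi.single_apply, ite_smul]
      module
    have e2 : ∑ j, w' j * δ j = ∑ j, w j * δ j + t * (δ i - ∑ j, w j * δ j) := by
      simp only [hw', Pi.add_apply, Pi.smul_apply, add_mul, smul_eq_mul, mul_assoc,
        Finset.sum_add_distrib, ← Finset.mul_sum]
      simp [Pi.single_apply, ite_mul]
      ring
    have h' : q w ≤ q w' := h
    simp only [q, e1, e2, hpc] at h'
    rw [norm_add_sq_real, norm_smul t, mul_pow, Real.norm_of_nonneg ht.le,
      real_inner_smul_right, real_inner_smul_left, inner_sub_right, real_inner_smul_right,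
      real_inner_self_eq_norm_sq] at h'
    nlinarith
  have lim : 0 ≤ inner ℝ p (c i) - 2 * ‖p‖ ^ 2 - δ i + ∑ j, w j * δ j := by
    by_contra! hneg
    set a := inner ℝ p (c i) - 2 * ‖p‖ ^ 2 - δ i + ∑ j, w j * δ j
    set b := ‖c i - (2 : ℝ) • p‖ ^ 2 / 4
    have hb : 0 ≤ b := by positivity
    have hab : 0 < b - a := by linarith
    -- For this `t`, `t * b ≤ -a / 2`, so the expression in `key` would be at most `a / 2 < 0`.
    have := key (-a / (2 * (b - a))) (by apply div_pos <;> linarith)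
      (by rw [div_le_one (by linarith)]; linarith)
    have h7 : -a / (2 * (b - a)) * b ≤ -a / 2 := by
      rw [div_mul_eq_mul_div, div_le_div_iff₀ (by linarith) two_pos]
      nlinarith
    linarith
  simp only [q, hpc, norm_smul, mul_pow] at hqw
  norm_num at hqw
  have e3 : inner ℝ (p - x i) (y - p - v i) = inner ℝ p (c i) - δ i - ‖p‖ ^ 2 := by
    simp only [hc, hδ, inner_sub_left, inner_sub_right, inner_add_right,
      real_inner_self_eq_norm_sq, real_inner_comm (x i) p]
    ring
  rw [e3]
  linarith

/-- **Minty's theorem**: if `A` is maximally monotone, then `Id + A` is surjective. -/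
theorem IsMaximalMonotoneOp.exists_mem_resolventOp [ProperSpace E] {A : E → Set E}
    (hA : IsMaximalMonotoneOp A) (y : E) : ∃ p, p ∈ resolventOp A y := by
  let Γ := {z : E × E // z.2 ∈ A z.1}
  -- By Thales, `C (x, v)` is the closed ball with diameter from `x` to `y - v`; hence the finite
  -- intersection property applies.
  let C : Γ → Set E := fun z => {p | 0 ≤ inner ℝ (p - z.1.1) (y - p - z.1.2)}
  have hclosed : ∀ z, IsClosed (C z) := fun z =>
    isClosed_le continuous_const (by fun_prop)
  have hbdd : ∀ z : Γ, C z ⊆ Metric.closedBall z.1.1 ‖y - z.1.2 - z.1.1‖ := by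
    intro z p hp
    have hp' : 0 ≤ inner ℝ (p - z.1.1) (y - p - z.1.2) := hp
    have e : y - p - z.1.2 = (y - z.1.2 - z.1.1) - (p - z.1.1) := by abel
    rw [e, inner_sub_right, real_inner_self_eq_norm_sq] at hp'
    have := real_inner_le_norm (p - z.1.1) (y - z.1.2 - z.1.1)
    rw [Metric.mem_closedBall, dist_eq_norm]
    by_contra! hlt
    nlinarith [norm_nonneg (y - z.1.2 - z.1.1)]
  obtain ⟨p, hp⟩ : ∃ p, ∀ z, p ∈ C z := by
    rcases isEmpty_or_nonempty Γ with hΓ | ⟨⟨z₀⟩⟩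
    · exact ⟨0, fun z => (hΓ.false z).elim⟩
    · have hcomp : IsCompact (C z₀) :=
        (isCompact_closedBall _ _).of_isClosed_subset (hclosed z₀) (hbdd z₀)
      obtain ⟨p, -, hp⟩ := hcomp.inter_iInter_nonempty C hclosed (by
        classical
        intro u
        have : Nonempty ↥(insert z₀ u) := ⟨⟨z₀, Finset.mem_insert_self _ _⟩⟩
        obtain ⟨p, hp⟩ := exists_monotone_related_of_fintype
          (fun i : ↥(insert z₀ u) => i.1.1.1) (fun i => i.1.1.2)
          (fun i j => hA.1 _ _ _ _ i.1.2 j.1.2) y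
        refine ⟨p, hp ⟨z₀, Finset.mem_insert_self _ _⟩, ?_⟩
        simp only [Set.mem_iInter]
        exact fun i hi => hp ⟨i, Finset.mem_insert_of_mem hi⟩)
      exact ⟨p, Set.mem_iInter.1 hp⟩
  have hrel : ∀ x u, u ∈ A x → 0 ≤ inner ℝ (p - x) (y - p - u) := fun x u hu => hp ⟨(x, u), hu⟩
  refine ⟨p, y - p, ?_, by abel⟩
  -- Adjoining `(p, y - p)` to the graph keeps it monotone, so by maximality the pair already
  -- belongs to it.
  refine hA.2 (fun x => {u | u ∈ A x ∨ (x = p ∧ u = y - p)}) ?_ (fun x u hu => Or.inl hu) p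
    (Or.inr ⟨rfl, rfl⟩)
  rintro x z u v (hu | ⟨rfl, rfl⟩) (hv | ⟨rfl, rfl⟩)
  · exact hA.1 _ _ _ _ hu hv
  · have := hrel _ _ hu
    rwa [← neg_sub u, ← neg_sub x, inner_neg_neg, real_inner_comm] at this
  · rw [real_inner_comm]
    exact hrel _ _ hv
  · simp

theorem IsMaximalMonotoneOp.smulOp {A : E → Set E} (hA : IsMaximalMonotoneOp A) {γ : ℝ}
    (hγ : 0 < γ) : IsMaximalMonotoneOp (smulOp γ A) := by
  have hmon : ∀ (c : ℝ) (B : E → Set E), 0 ≤ c → IsMonotoneOp B →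
      IsMonotoneOp (WeakMVI.smulOp c B) := by
    rintro c B hc hB x y _ _ ⟨a, ha, rfl⟩ ⟨b, hb, rfl⟩
    rw [← smul_sub, real_inner_smul_left]
    exact mul_nonneg hc (hB _ _ _ _ ha hb)
  refine ⟨hmon γ A hγ.le hA.1, fun B hB hAB x u hu => ?_⟩
  refine ⟨γ⁻¹ • u, ?_, by rw [smul_inv_smul₀ hγ.ne']⟩
  refine hA.2 (WeakMVI.smulOp γ⁻¹ B) (hmon _ B (inv_nonneg.2 hγ.le) hB) (fun z a ha => ?_) x
    ⟨u, hu, rfl⟩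
  exact ⟨γ • a, hAB z ⟨a, ha, rfl⟩, by rw [inv_smul_smul₀ hγ.ne']⟩

/-- Resolvents of monotone operators are nonexpansive. -/
theorem IsMonotoneOp.norm_sub_le_of_mem_resolventOp {A : E → Set E} (hA : IsMonotoneOp A)
    {x y p q : E} (hp : p ∈ resolventOp A x) (hq : q ∈ resolventOp A y) :
    ‖p - q‖ ≤ ‖x - y‖ := by
  obtain ⟨a, ha, rfl⟩ := hp
  obtain ⟨b, hb, rfl⟩ := hq
  have h := hA _ _ _ _ ha hb
  rw [real_inner_comm] at h
  have e : p + a - (q + b) = (p - q) + (a - b) := by abel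
  have h2 := norm_add_sq_real (p - q) (a - b)
  rw [e]
  refine (sq_le_sq₀ (norm_nonneg _) (norm_nonneg _)).1 ?_
  nlinarith [sq_nonneg ‖a - b‖]

theorem IsMaximalMonotoneOp.hasSingleValuedResolvent [ProperSpace E] {A : E → Set E}
    (hA : IsMaximalMonotoneOp A) : HasSingleValuedResolvent A := by
  intro x
  obtain ⟨p, hp⟩ := hA.exists_mem_resolventOp x
  refine ⟨p, hp, fun q hq => ?_⟩
  have := hA.1.norm_sub_le_of_mem_resolventOp hq hp
  rw [sub_self, norm_zero] at this
  exact sub_eq_zero.1 (norm_le_zero_iff.1 this)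

/-- The resolvent of `η (F + G)` at `x` consists of the fixed points of
`p ↦ J_{η G} (x - η F p)`. -/
theorem mem_resolventOp_smulOp_addOp {F : E → E} {G : E → Set E} {η : ℝ} {x p : E} :
    p ∈ resolventOp (WeakMVI.smulOp η (addOp F G)) x ↔
      p ∈ resolventOp (WeakMVI.smulOp η G) (x - η • F p) := by
  constructor
  · rintro ⟨_, ⟨_, ⟨g, hg, rfl⟩, rfl⟩, hx⟩
    exact ⟨_, ⟨g, hg, rfl⟩, by rw [hx]; module⟩
  · rintro ⟨_, ⟨g, hg, rfl⟩, hx⟩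
    exact ⟨_, ⟨_, ⟨g, hg, rfl⟩, rfl⟩, by rw [sub_eq_iff_eq_add] at hx; rw [hx]; module⟩

/-- Nonexpansiveness of `J_{ηG}` makes `p ↦ J_{ηG} (x - η F p)` an `ηL`-contraction. -/
theorem hasSingleValuedResolvent_smulOp_addOp [ProperSpace E] {F : E → E} {G : E → Set E}
    {L : ℝ≥0} {η : ℝ} (hF : LipschitzWith L F) (hG : IsMaximalMonotoneOp G) (hη : 0 < η)
    (hηL : η * L < 1) : HasSingleValuedResolvent (WeakMVI.smulOp η (addOp F G)) := by
  intro x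
  have hηG := hG.smulOp hη
  have hJ := hηG.hasSingleValuedResolvent
  let T : E → E := fun p => J (WeakMVI.smulOp η G) (x - η • F p)
  have hT : ContractingWith (η.toNNReal * L) T := by
    refine ⟨by rw [← NNReal.coe_lt_coe]; simpa [hη.le] using hηL,
      LipschitzWith.of_dist_le_mul fun p q => ?_⟩
    have h1 := hηG.1.norm_sub_le_of_mem_resolventOp (hJ.J_mem (x - η • F p))
      (hJ.J_mem (x - η • F q))
    have h2 := hF.dist_le_mul p q
    rw [dist_eq_norm, dist_eq_norm] at *
    have e : x - η • F p - (x - η • F q) = -(η • (F p - F q)) := by module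
    rw [e, norm_neg, norm_smul, Real.norm_of_nonneg hη.le] at h1
    refine h1.trans ?_
    rw [NNReal.coe_mul, Real.coe_toNNReal _ hη.le, mul_assoc]
    gcongr
  have hfix : ∀ p, p ∈ resolventOp (WeakMVI.smulOp η (addOp F G)) x ↔ T p = p := by
    intro p
    rw [mem_resolventOp_smulOp_addOp]
    constructor
    · exact fun hp => (hJ _).unique (hJ.J_mem _) hp
    · intro hp
      have := hJ.J_mem (x - η • F p)
      rwa [show J (WeakMVI.smulOp η G) (x - η • F p) = p from hp] at this
  refine ⟨hT.fixedPoint T, (hfix _).2 hT.fixedPoint_isFixedPt, fun q hq => ?_⟩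
  exact hT.fixedPoint_unique ((hfix q).1 hq)

end Minty

end WeakMVI

namespace WeakMVI

/-! ### Runs and costs of composed programs. -/

namespace Prog

variable {E α β : Type} (oF : E → E) (oR : ℝ → E → E)

theorem run_bind (p : Prog E α) (f : α → Prog E β) :
    (p.bind f).run oF oR = (f (p.run oF oR)).run oF oR := by
  induction p with
  | ret a => rfl
  | evalF x c ih => exact ih _
  | evalRes γ x c ih => exact ih _

theorem countF_bind (p : Prog E α) (f : α → Prog E β) :
    (p.bind f).countF oF oR = p.countF oF oR + (f (p.run oF oR)).countF oF oR := by
  induction p with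
  | ret a => simp [bind, countF, run]
  | evalF x c ih => simp only [bind, countF, run, ih]; omega
  | evalRes γ x c ih => simp only [bind, countF, run, ih]

theorem countRes_bind (p : Prog E α) (f : α → Prog E β) :
    (p.bind f).countRes oF oR = p.countRes oF oR + (f (p.run oF oR)).countRes oF oR := by
  induction p with
  | ret a => simp [bind, countRes, run]
  | evalF x c ih => simp only [bind, countRes, run, ih]
  | evalRes γ x c ih => simp only [bind, countRes, run, ih]; omega

end Prog

/-! ### Linear convergence and cost of the inner method. -/

section ForwardBackwardForward

/-- One forward-backward-forward step from `z` through `w` to `z⁺`, with `q = z - w`, `r = z⁺ - w`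
and `p = w - z⋆`. -/
theorem norm_add_sq_le_of_fbf {E : Type*} [NormedAddCommGroup E] [InnerProductSpace ℝ E]
    {p q r : E} {κ : ℝ} (hκ : 0 ≤ κ) (hκ1 : κ ≤ 1) (hr : ‖r‖ ≤ 1 / 2 * ‖q‖)
    (h : κ / 2 * ‖p‖ ^ 2 ≤ inner ℝ (q - r) p) :
    ‖p + r‖ ^ 2 ≤ (1 - 3 / 8 * κ) * ‖p + q‖ ^ 2 := by
  have hpr := norm_add_sq_real p r
  have hpq := norm_add_sq_real p q
  have hr2 : ‖r‖ ^ 2 ≤ (1 / 2 * ‖q‖) ^ 2 := by gcongr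
  have hcs := real_inner_le_norm p q
  rw [inner_sub_left, real_inner_comm p q, real_inner_comm p r] at h
  -- The hypotheses leave `‖p + q‖² - κ ‖p‖² - 3/4 ‖q‖²`. These Young weights give `3/8 ‖p + q‖² ≤
  -- ‖p‖² + 3/5 ‖q‖²`, and `3/5 κ ≤ 3/4`.
  have hyoung : ‖p + q‖ ^ 2 ≤ 8 / 3 * ‖p‖ ^ 2 + 8 / 5 * ‖q‖ ^ 2 := by
    nlinarith [sq_nonneg (5 * ‖p‖ - 3 * ‖q‖)]
  have h1 := mul_le_mul_of_nonneg_left hyoung hκ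
  have h2 := mul_le_mul_of_nonneg_right hκ1 (sq_nonneg ‖q‖)
  nlinarith [sq_nonneg ‖q‖]

variable {E : Type} [NormedAddCommGroup E] [InnerProductSpace ℝ E]

/-- The inner iteration of the outer step `k`, run for an arbitrary number of steps. -/
noncomputable def fbfResolvent (η L : ℝ) (x : E) (N : ℕ) : Prog E E :=
  fbf (fun τ w => .evalRes (τ * η) w .ret) (fun z => .evalF z fun v => .ret (z + η • v))
    (1 + η * L) x N

theorem run_fbfResolvent_succ (F : E → E) (oR : ℝ → E → E) (η L : ℝ) (x : E) (t : ℕ) :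
    ∃ z w : E, z = (fbfResolvent η L x t).run F oR ∧
      w = oR (1 / (2 * (1 + η * L)) * η) (z - (1 / (2 * (1 + η * L))) • (z + η • F z - x)) ∧
      (fbfResolvent η L x (t + 1)).run F oR
        = w + (1 / (2 * (1 + η * L))) • ((z + η • F z) - (w + η • F w)) := by
  refine ⟨_, _, rfl, rfl, ?_⟩
  simp only [fbfResolvent, fbf, Prog.run_bind, Prog.run]
  module

theorem countF_fbfResolvent (F : E → E) (oR : ℝ → E → E) (η L : ℝ) (x : E) (t : ℕ) :
    (fbfResolvent η L x t).countF F oR = 2 * t := by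
  induction t with
  | zero => rfl
  | succ t ih =>
    simp only [fbfResolvent] at ih
    simp only [fbfResolvent, fbf, Prog.countF_bind, ih, Prog.countF]
    omega

theorem countRes_fbfResolvent (F : E → E) (oR : ℝ → E → E) (η L : ℝ) (x : E) (t : ℕ) :
    (fbfResolvent η L x t).countRes F oR = t := by
  induction t with
  | zero => rfl
  | succ t ih =>
    simp only [fbfResolvent] at ih
    simp only [fbfResolvent, fbf, Prog.countRes_bind, ih, Prog.countRes]

theorem kmCalls_le (F : E → E) (G : E → Set E) (η L ρ : ℝ) (x₀ : E) (k : ℕ) :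
    kmCalls F G η L ρ x₀ k ≤ 2 * innerIters η L k := by
  have h1 := countF_fbfResolvent F (resOracle G) η L (kmIterate F G η L ρ x₀ k) (innerIters η L k)
  have h2 := countRes_fbfResolvent F (resOracle G) η L (kmIterate F G η L ρ x₀ k)
    (innerIters η L k)
  rw [fbfResolvent] at h1 h2
  simp only [kmCalls, Prog.oracleCalls, kmStep, approxResolvent, Prog.countF_bind,
    Prog.countRes_bind, h1, h2, Prog.countF, Prog.countRes]
  omega

/-- Linear convergence of the inner iteration to the resolvent of `η (F + G)`. -/
theorem norm_run_fbfResolvent_sub_sq_le {F : E → E} {G : E → Set E} {L : ℝ≥0} {η : ℝ}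
    (hF : LipschitzWith L F) (hG : IsMonotoneOp G)
    (hres : ∀ γ : ℝ, 0 < γ → HasSingleValuedResolvent (smulOp γ G))
    (hη : 0 < η) (hηL : η * L < 1) {x zs : E}
    (hzs : zs ∈ resolventOp (smulOp η (addOp F G)) x) (t : ℕ) :
    ‖(fbfResolvent η L x t).run F (resOracle G) - zs‖ ^ 2
      ≤ (1 - 3 / 8 * ((1 - η * L) / (1 + η * L))) ^ t * ‖x - zs‖ ^ 2 := by
  induction t with
  | zero => simp [fbfResolvent, fbf, Prog.run]
  | succ t ih =>
    obtain ⟨z, w, hz, hw, hrun⟩ := run_fbfResolvent_succ F (resOracle G) η L x t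
    rw [← hz] at ih
    rw [hrun]
    have hηL0 : 0 ≤ η * L := by positivity
    set ℓ := 1 + η * L with hℓ
    have hℓ0 : 0 < ℓ := by linarith
    set τ := 1 / (2 * ℓ) with hτ
    have hτ0 : 0 < τ := by positivity
    set κ := (1 - η * L) / ℓ with hκd
    have hκ : 0 ≤ κ := div_nonneg (by linarith) hℓ0.le
    have hκ1 : κ ≤ 1 := by rw [hκd, div_le_one hℓ0]; linarith
    obtain ⟨_, ⟨a, ha, rfl⟩, hwa⟩ := (hres (τ * η) (by positivity)).J_mem
      (z - τ • (z + η • F z - x))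
    rw [show J (smulOp (τ * η) G) (z - τ • (z + η • F z - x)) = w from hw.symm] at ha hwa
    obtain ⟨_, ⟨_, ⟨b, hb, rfl⟩, rfl⟩, hxb⟩ := hzs
    have hmon := hG _ _ _ _ ha hb
    have hLip : ∀ u v, ‖F u - F v‖ ≤ L * ‖u - v‖ := fun u v => by
      simpa [dist_eq_norm] using hF.dist_le_mul u v
    have hstep : ‖(w - zs) + τ • ((z + η • F z) - (w + η • F w))‖ ^ 2
        ≤ (1 - 3 / 8 * κ) * ‖(w - zs) + (z - w)‖ ^ 2 := by
      refine norm_add_sq_le_of_fbf hκ hκ1 ?_ ?_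
      · have e : (z + η • F z) - (w + η • F w) = (z - w) + η • (F z - F w) := by module
        have h1 : ‖(z + η • F z) - (w + η • F w)‖ ≤ ℓ * ‖z - w‖ := by
          rw [e]
          refine (norm_add_le _ _).trans ?_
          rw [norm_smul, Real.norm_of_nonneg hη.le, hℓ]
          nlinarith [mul_le_mul_of_nonneg_left (hLip z w) hη.le]
        rw [norm_smul, Real.norm_of_nonneg hτ0.le]
        refine (mul_le_mul_of_nonneg_left h1 hτ0.le).trans_eq ?_
        rw [hτ]; field_simp
      -- Subtracting the inclusions for `w` and `zs` cancels `x`; what remains is strongly monotone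
      -- with modulus `1 - ηL`, and `τ (1 - ηL) = κ / 2`.
      · have e : (z - w) - τ • ((z + η • F z) - (w + η • F w))
            = τ • ((w - zs) + η • (F w - F zs) + η • (a - b)) := by
          have h2 : z - w = τ • (z + η • F z - x) + (τ * η) • a := by
            calc z - w = (z - τ • (z + η • F z - x)) + τ • (z + η • F z - x) - w := by abel
              _ = _ := by rw [hwa]; abel
          rw [h2, hxb]
          module
        have hcs := neg_le_of_abs_le (abs_real_inner_le_norm (F w - F zs) (w - zs))
        have h3 := mul_le_mul_of_nonneg_right (hLip w zs) (norm_nonneg (w - zs))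
        rw [e, real_inner_smul_left, inner_add_left, inner_add_left, real_inner_smul_left,
          real_inner_smul_left, real_inner_self_eq_norm_sq]
        have h4 : (1 - η * L) * ‖w - zs‖ ^ 2 ≤ ‖w - zs‖ ^ 2
            + η * inner ℝ (F w - F zs) (w - zs) + η * inner ℝ (a - b) (w - zs) := by
          nlinarith [mul_nonneg hη.le hmon]
        refine le_trans (le_of_eq ?_) (mul_le_mul_of_nonneg_left h4 hτ0.le)
        rw [hκd, hτ]; field_simp
    rw [show w + τ • ((z + η • F z) - (w + η • F w)) - zs
      = (w - zs) + τ • ((z + η • F z) - (w + η • F w)) by abel]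
    rw [show (w - zs) + (z - w) = z - zs by abel] at hstep
    refine hstep.trans ?_
    rw [pow_succ' (1 - 3 / 8 * κ), mul_assoc]
    exact mul_le_mul_of_nonneg_left ih (by linarith)

/-- The squared relative accuracy of the inner iteration is summable in `k`. -/
theorem pow_innerIters_le {L η : ℝ} (hL : 0 ≤ η * L) (hηL : η * L < 1) (k : ℕ) :
    (1 - 3 / 8 * ((1 - η * L) / (1 + η * L))) ^ innerIters η L k
      ≤ 1 / (1.9 * √((k : ℝ) + 1)) ^ 3 := by
  set κ := (1 - η * L) / (1 + η * L) with hκd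
  have hκ : 0 < κ := div_pos (by linarith) (by linarith)
  have hκ1 : κ ≤ 1 := by rw [hκd, div_le_one (by linarith)]; linarith
  set a := √((k : ℝ) + 1) with ha
  have ha0 : 0 < a := by positivity
  have ha2 : a ^ 2 = (k : ℝ) + 1 := Real.sq_sqrt (by positivity)
  set c := 8 * ((k : ℝ) + 1) * Real.log ((k : ℝ) + 2) ^ 2 with hc
  have hlog : 0.69 ≤ Real.log ((k : ℝ) + 2) :=
    (by linarith [Real.log_two_gt_d9] : (0.69 : ℝ) ≤ Real.log 2).trans
      (Real.log_le_log two_pos (by linarith [k.cast_nonneg (α := ℝ)]))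
  -- `8 * 0.69² > 1.9²`: the squared logarithm is used only through its lower bound at `k = 0`. The
  -- power then decays like `c ^ (-3/2)`, since `3/8 * 4 = 3/2`.
  have hc' : (1.9 * a) ^ 2 ≤ c := by
    rw [hc, ← ha2]
    nlinarith [mul_le_mul_of_nonneg_left (pow_le_pow_left₀ (by norm_num) hlog 2) (sq_nonneg a)]
  have hlogc : 2 * Real.log (1.9 * a) ≤ Real.log c := by
    have := Real.log_le_log (by positivity) hc'
    rwa [Real.log_pow] at this
  have hN : 4 / κ * Real.log c ≤ innerIters η L k := by
    have := Nat.le_ceil (4 * (1 + η * L) / (1 - η * L) * Real.log c)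
    refine le_trans (le_of_eq ?_) this
    rw [hκd]; field_simp
  have h1 : (1 - 3 / 8 * κ) ^ innerIters η L k
      ≤ Real.exp (-(3 / 8 * κ)) ^ innerIters η L k :=
    pow_le_pow_left₀ (by linarith) (by linarith [Real.add_one_le_exp (-(3 / 8 * κ))]) _
  refine h1.trans ?_
  rw [← Real.exp_nat_mul, one_div, ← Real.exp_log (show 0 < 1.9 * a by positivity),
    ← Real.exp_nat_mul, ← Real.exp_neg, Real.exp_le_exp]
  have h2 := mul_le_mul_of_nonneg_left hN (show 0 ≤ 3 / 8 * κ by positivity)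
  have h3 : 3 / 8 * κ * (4 / κ * Real.log c) = 3 / 2 * Real.log c := by field_simp; ring
  push_cast
  linarith

end ForwardBackwardForward

/-! ### The inexact outer iteration. -/

section KrasnoselskiiMann

/-- One inexact Krasnosel'skii-Mann step, in terms of `u = x - x⋆`, the residual `r = x - T x` and
the error `e` of the approximation of `T x`. -/
theorem norm_sq_le_of_kmStep {E : Type*} [NormedAddCommGroup E] [InnerProductSpace ℝ E]
    {u r e : E} {α ε : ℝ} (hα : 0 ≤ α) (h : α * ‖r‖ ^ 2 ≤ inner ℝ r u) (hε : 0 ≤ ε)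
    (he : ‖e‖ ^ 2 ≤ ε * ‖r‖ ^ 2) :
    ‖u - α • r + α • e‖ ^ 2 + α ^ 2 * ‖r‖ ^ 2 / 2 ≤ (1 + 2 * ε) * ‖u‖ ^ 2 := by
  have h1 : ‖u - α • r‖ ^ 2 ≤ ‖u‖ ^ 2 - α ^ 2 * ‖r‖ ^ 2 := by
    rw [norm_sub_sq_real, norm_smul, Real.norm_of_nonneg hα, real_inner_smul_right,
      real_inner_comm]
    nlinarith [mul_le_mul_of_nonneg_left h hα]
  set y := u - α • r
  have h2 : ‖y + α • e‖ ≤ ‖y‖ + α * ‖e‖ := by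
    refine (norm_add_le _ _).trans_eq ?_
    rw [norm_smul, Real.norm_of_nonneg hα]
  have h3 : ‖y + α • e‖ ^ 2 ≤ (‖y‖ + α * ‖e‖) ^ 2 := by gcongr
  have h4 : α ^ 2 * ‖e‖ ^ 2 ≤ ε * (α ^ 2 * ‖r‖ ^ 2) := by
    nlinarith [mul_le_mul_of_nonneg_left he (sq_nonneg α)]
  set s := α ^ 2 * ‖r‖ ^ 2 with hs
  have hs0 : 0 ≤ s := by positivity
  -- Young's inequality with weights `2ε` and `1/2`, proved after squaring because only `‖e‖²` is
  -- controlled.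
  have h5 : 2 * (‖y‖ * (α * ‖e‖)) ≤ 2 * ε * ‖y‖ ^ 2 + s / 2 := by
    have hsq : (2 * (‖y‖ * (α * ‖e‖))) ^ 2 ≤ (2 * ε * ‖y‖ ^ 2 + s / 2) ^ 2 := by
      nlinarith [mul_le_mul_of_nonneg_left h4 (sq_nonneg ‖y‖),
        sq_nonneg (2 * ε * ‖y‖ ^ 2 - s / 2)]
    exact (sq_le_sq₀ (by positivity) (by positivity)).1 hsq
  nlinarith [mul_le_mul_of_nonneg_left h1 hε]

theorem sum_one_div_sqrt_cube_le (K : ℕ) :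
    ∑ k ∈ Finset.range K, 1 / (1.9 * √((k : ℝ) + 1)) ^ 3 ≤ 1 / 2 := by
  -- Telescoping comparison with the integral of `t ^ (-3/2)`; the constant suffices as `3 / 1.9³ <
  -- 1/2`.
  suffices h : ∀ n : ℕ, ∑ k ∈ Finset.range (n + 1), 1 / √((k : ℝ) + 1) ^ 3
      ≤ 3 - 2 / √((n : ℝ) + 1) by
    rcases K with _ | n
    · norm_num
    have e : ∀ k : ℕ, 1 / (1.9 * √((k : ℝ) + 1)) ^ 3 = 1 / 1.9 ^ 3 * (1 / √((k : ℝ) + 1) ^ 3) :=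
      fun k => by rw [mul_pow, one_div_mul_one_div]
    simp only [e, ← Finset.mul_sum]
    have h0 : 0 ≤ 2 / √((n : ℝ) + 1) := by positivity
    nlinarith [h n]
  intro n
  induction n with
  | zero => norm_num
  | succ n ih =>
    rw [Finset.sum_range_succ]
    push_cast
    set a := √((n : ℝ) + 1) with ha
    set b := √((n : ℝ) + 1 + 1) with hb
    have ha0 : 0 < a := by positivity
    have hb0 : 0 < b := by positivity
    have ha2 : a ^ 2 = (n : ℝ) + 1 := Real.sq_sqrt (by positivity)
    have hb2 : b ^ 2 = (n : ℝ) + 1 + 1 := Real.sq_sqrt (by positivity)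
    have hab : a ≤ b := Real.sqrt_le_sqrt (by linarith)
    have key : 1 / b ^ 3 ≤ 2 / a - 2 / b := by
      rw [div_sub_div _ _ ha0.ne' hb0.ne', div_le_div_iff₀ (by positivity) (by positivity)]
      have h1 : (b - a) * (b + a) = 1 := by nlinarith
      have h2 : 1 ≤ 2 * b * (b - a) := by nlinarith
      have h3 := mul_le_mul_of_nonneg_left h2 (show 0 ≤ b ^ 2 by positivity)
      nlinarith [mul_pos ha0 hb0]
    linarith

/-- A quasi-Fejér recursion with summable relative errors. -/
theorem sum_le_exp_mul_of_recursion {D s ε : ℕ → ℝ} (hD : 0 ≤ D 0) (hs : ∀ k, 0 ≤ s k) (hε : ∀ k, 0 ≤ ε k)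
    (h : ∀ k, D (k + 1) + s k ≤ (1 + ε k) * D k) (K : ℕ) :
    D K + ∑ k ∈ Finset.range K, s k ≤ Real.exp (∑ k ∈ Finset.range K, ε k) * D 0 := by
  induction K with
  | zero => simp
  | succ K ih =>
    rw [Finset.sum_range_succ, Finset.sum_range_succ, add_comm (∑ k ∈ Finset.range K, ε k),
      Real.exp_add, mul_assoc]
    have hS : 0 ≤ ∑ k ∈ Finset.range K, s k := Finset.sum_nonneg fun k _ => hs k
    have h1 : D (K + 1) + (∑ k ∈ Finset.range K, s k + s K)
        ≤ (1 + ε K) * (D K + ∑ k ∈ Finset.range K, s k) := by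
      nlinarith [h K, mul_nonneg (hε K) hS]
    refine h1.trans ((mul_le_mul_of_nonneg_left ih (by linarith [hε K])).trans ?_)
    exact mul_le_mul_of_nonneg_right (by linarith [Real.add_one_le_exp (ε K)]) (by positivity)

/-- Test the weak Minty inequality at `p` with `u = (x - p) / η`, and add `‖x - p‖²`. -/
theorem IsWeakMVISolution.le_inner_sub {E : Type*} [NormedAddCommGroup E] [InnerProductSpace ℝ E]
    {A : E → Set E} {ρ η : ℝ} {xs x p : E} (hxs : IsWeakMVISolution ρ A xs) (hη : 0 < η)
    (hp : p ∈ resolventOp (smulOp η A) x) :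
    (1 - ρ / η) * ‖x - p‖ ^ 2 ≤ inner ℝ (x - p) (x - xs) := by
  obtain ⟨_, ⟨w, hw, rfl⟩, rfl⟩ := hp
  have h := mul_le_mul_of_nonneg_left (hxs.2 p w hw) hη.le
  rw [add_sub_cancel_left, norm_smul, Real.norm_of_nonneg hη.le,
    show p + η • w - xs = (p - xs) + η • w by abel, inner_add_right, real_inner_smul_left,
    real_inner_self_eq_norm_sq, norm_smul, Real.norm_of_nonneg hη.le]
  have e : (1 - ρ / η) * (η * ‖w‖) ^ 2 = η * (-ρ * ‖w‖ ^ 2) + (η * ‖w‖) ^ 2 := by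
    field_simp
    ring
  linarith

end KrasnoselskiiMann

end WeakMVI

/-! ### Assembling the bound. -/

namespace WeakMVI

theorem norm_kmIterate_succ_sq_le {E : Type} [NormedAddCommGroup E] [InnerProductSpace ℝ E]
    {F : E → E} {G : E → Set E} {L : ℝ≥0} {ρ η : ℝ} {xs : E}
    (hF : LipschitzWith L F) (hG : IsMonotoneOp G)
    (hres : ∀ γ : ℝ, 0 < γ → HasSingleValuedResolvent (smulOp γ G))
    (hresA : HasSingleValuedResolvent (smulOp η (addOp F G)))
    (hη : 0 < η) (hρη : ρ < η) (hηL : η * L < 1)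
    (hxs : IsWeakMVISolution ρ (addOp F G) xs) (x₀ : E) (k : ℕ) :
    ‖kmIterate F G η L ρ x₀ (k + 1) - xs‖ ^ 2
        + (1 - ρ / η) ^ 2 * ‖kmIterate F G η L ρ x₀ k
            - J (smulOp η (addOp F G)) (kmIterate F G η L ρ x₀ k)‖ ^ 2 / 2
      ≤ (1 + 2 * (1 / (1.9 * √((k : ℝ) + 1)) ^ 3)) * ‖kmIterate F G η L ρ x₀ k - xs‖ ^ 2 := by
  have hsucc : kmIterate F G η L ρ x₀ (k + 1)
      = (1 - (1 - ρ / η)) • kmIterate F G η L ρ x₀ k + (1 - ρ / η) •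
        (fbfResolvent η L (kmIterate F G η L ρ x₀ k) (innerIters η L k)).run F (resOracle G) := by
    simp only [kmIterate, kmStep, Prog.run_bind, Prog.run]
    rfl
  set x := kmIterate F G η L ρ x₀ k
  set z := (fbfResolvent η L x (innerIters η L k)).run F (resOracle G) with hz
  set p := J (smulOp η (addOp F G)) x
  have hp : p ∈ resolventOp (smulOp η (addOp F G)) x := hresA.J_mem x
  have herr : ‖z - p‖ ^ 2 ≤ 1 / (1.9 * √((k : ℝ) + 1)) ^ 3 * ‖x - p‖ ^ 2 :=
    (norm_run_fbfResolvent_sub_sq_le hF hG hres hη hηL hp _).trans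
      (mul_le_mul_of_nonneg_right (pow_innerIters_le (by positivity) hηL k) (sq_nonneg _))
  have hα : 0 ≤ 1 - ρ / η := by rw [sub_nonneg, div_le_one hη]; exact hρη.le
  have := norm_sq_le_of_kmStep hα (hxs.le_inner_sub hη hp) (by positivity) herr
  rwa [show x - xs - (1 - ρ / η) • (x - p) + (1 - ρ / η) • (z - p)
    = kmIterate F G η L ρ x₀ (k + 1) - xs by rw [hsucc]; module] at this

end WeakMVI

theorem theorem2 {d : ℕ} (L : ℝ≥0)
    (F : EuclideanSpace ℝ (Fin d) → EuclideanSpace ℝ (Fin d))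
    (G : EuclideanSpace ℝ (Fin d) → Set (EuclideanSpace ℝ (Fin d)))
    (hF : LipschitzWith L F) (hG : WeakMVI.IsMaximalMonotoneOp G)
    (ρ η : ℝ) (hρ : 0 < ρ) (hρη : ρ < η) (hηL : η * L < 1)
    (xs : EuclideanSpace ℝ (Fin d))
    (hxs : WeakMVI.IsWeakMVISolution ρ (WeakMVI.addOp F G) xs)
    (x₀ : EuclideanSpace ℝ (Fin d)) :
    -- the resolvents that the algorithm evaluates and the one in the bound are well defined
    (∀ γ : ℝ, 0 < γ → WeakMVI.HasSingleValuedResolvent (WeakMVI.smulOp γ G)) ∧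
    WeakMVI.HasSingleValuedResolvent (WeakMVI.smulOp η (WeakMVI.addOp F G)) ∧
    -- the bound on the average squared residual
    (∀ K : ℕ, 1 ≤ K →
      1 / (K : ℝ) * ∑ k ∈ Finset.range K, 1 / η ^ 2 *
          ‖WeakMVI.kmIterate F G η L ρ x₀ k
            - WeakMVI.J (WeakMVI.smulOp η (WeakMVI.addOp F G))
                (WeakMVI.kmIterate F G η L ρ x₀ k)‖ ^ 2
        ≤ 11 * ‖x₀ - xs‖ ^ 2 / ((η - ρ) ^ 2 * K)) ∧
    -- the cost of iteration `k`
    (∀ k : ℕ, WeakMVI.kmCalls F G η L ρ x₀ k ≤ 2 * WeakMVI.innerIters η L k) := by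

  have hη : 0 < η := hρ.trans hρη
  have hres : ∀ γ : ℝ, 0 < γ → WeakMVI.HasSingleValuedResolvent (WeakMVI.smulOp γ G) :=
    fun γ hγ => (hG.smulOp hγ).hasSingleValuedResolvent
  have hresA := WeakMVI.hasSingleValuedResolvent_smulOp_addOp hF hG hη hηL
  refine ⟨hres, hresA, fun K hK => ?_, WeakMVI.kmCalls_le F G η L ρ x₀⟩
  set X := WeakMVI.kmIterate F G η L ρ x₀ with hX
  set r : ℕ → ℝ := fun k => ‖X k - WeakMVI.J (WeakMVI.smulOp η (WeakMVI.addOp F G)) (X k)‖ ^ 2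
  have hsum := WeakMVI.sum_le_exp_mul_of_recursion (D := fun k => ‖X k - xs‖ ^ 2)
    (s := fun k => (1 - ρ / η) ^ 2 * r k / 2)
    (ε := fun k => 2 * (1 / (1.9 * √((k : ℝ) + 1)) ^ 3)) (by positivity)
    (fun k => by positivity) (fun k => by positivity)
    (fun k => WeakMVI.norm_kmIterate_succ_sq_le hF hG.1 hres hresA hη hρη hηL hxs x₀ k) K
  rw [← Finset.mul_sum, ← Finset.sum_div, ← Finset.mul_sum,
    show X 0 = x₀ from rfl] at hsum
  -- The recursion carries only half of `α² r k`, so `11 / 2` here becomes `11`.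
  have hexp : Real.exp (2 * ∑ k ∈ Finset.range K, 1 / (1.9 * √((k : ℝ) + 1)) ^ 3) ≤ 11 / 2 :=
    (Real.exp_le_exp.2 (by linarith [WeakMVI.sum_one_div_sqrt_cube_le K] : _ ≤ (1 : ℝ))).trans
      (by linarith [Real.exp_one_lt_d9])
  have hbound : (1 - ρ / η) ^ 2 * ∑ k ∈ Finset.range K, r k ≤ 11 * ‖x₀ - xs‖ ^ 2 := by
    have := mul_le_mul_of_nonneg_right hexp (sq_nonneg ‖x₀ - xs‖)
    have := sq_nonneg ‖X K - xs‖
    linarith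
  have hK0 : (0 : ℝ) < K := by exact_mod_cast hK
  have hηρ : 0 < η - ρ := by linarith
  rw [← Finset.mul_sum]
  change 1 / (K : ℝ) * (1 / η ^ 2 * ∑ k ∈ Finset.range K, r k) ≤ _
  rw [le_div_iff₀ (by positivity)]
  refine le_trans (le_of_eq ?_) hbound
  field_simp
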